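/- **Theorem 1.6** (Unweighted Algorithmic Restoration Lemma). All graphs are finite, simple, undirected and unweighted, and running times are counted on a deterministic unit-cost random access machine (addition, truncated subtraction, tests, indirect addressing) whose program does not depend on the input. There are such an algorithm and an absolute constant $C$ with the following property. Let the input consist of a graph $G$ with $n$ nodes, a set $F \subseteq E(G)$ of $|F| = f$ edge faults, a path $\pi$ that is a shortest path between its endpoints in $G \setminus F$, and an integer $k \ge 1$; here $G$ is given by its adjacency matrix, $F$ by a list of its edges in any order, and $\pi$ by its sequence of nodes. Then the algorithm halts after a number of steps that is bounded by a fixed polynomial in $n$ and $f$ (independent of $k$), and it returns - a partition $\pi = \pi_0 \circ \pi_1 \circ \dots \circ \pi_q$ of $\pi$ into $q + 1 \le C k$ consecutive subpaths, each with at least one edge if $\pi$ has an edge, and - fault sets $F_0, \dots, F_q \subseteq F$ with $|F_i| \le f/k$ for each $i$, such that each $\pi_i$ is a shortest path between its endpoints in $G \setminus F_i$. -/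

import Mathlib

namespace PathRestoration

/-! ### The machine model

A unit-cost random access machine, programmed by structured programs.  The memory consists of
arrays, named by natural numbers; every array cell holds a natural number and is addressed
indirectly.  A program mentions only finitely many array names, all of them fixed in its text.
The only arithmetic is addition and truncated subtraction, so that a computation of `T` steps
can lengthen the binary representation of the numbers by at most `O(T)` digits. -/

/-- A memory content: `σ a i` is the number in cell `i` of array `a`. -/
abbrev Memory : Type := ℕ → ℕ → ℕ

/-- Arithmetic expressions. -/
inductive Expr : Type
  | lit (c : ℕ) : Expr
  | get (a : ℕ) (i : Expr) : Expr
  | add (x y : Expr) : Expr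
  | sub (x y : Expr) : Expr

/-- The value of an expression (`sub` is truncated at `0`). -/
def Expr.eval (σ : Memory) : Expr → ℕ
  | .lit c => c
  | .get a i => σ a (i.eval σ)
  | .add x y => x.eval σ + y.eval σ
  | .sub x y => x.eval σ - y.eval σ

/-- The number of elementary operations in the evaluation of an expression. -/
def Expr.cost : Expr → ℕ
  | .lit _ => 1
  | .get _ i => 1 + i.cost
  | .add x y => 1 + x.cost + y.cost
  | .sub x y => 1 + x.cost + y.cost

/-- Programs.  A test counts as true when its value is nonzero. -/
inductive Prog : Type
  | skip : Prog
  /-- `store a i e` writes the value of `e` into cell `i` of array `a`. -/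
  | store (a : ℕ) (i e : Expr) : Prog
  | seq (p₁ p₂ : Prog) : Prog
  | ite (b : Expr) (p₁ p₂ : Prog) : Prog
  /-- `loop b p` repeats `p` as long as the test `b` is true. -/
  | loop (b : Expr) (p : Prog) : Prog

/-- The memory after writing `v` into cell `i` of array `a`. -/
def Memory.set (σ : Memory) (a i v : ℕ) : Memory :=
  Function.update σ a (Function.update (σ a) i v)

/-- `Runs p σ σ' T`: started with memory `σ`, the program `p` halts with memory `σ'` after
exactly `T` steps. -/
inductive Runs : Prog → Memory → Memory → ℕ → Prop
  | skip (σ : Memory) : Runs .skip σ σ 1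
  | store (a : ℕ) (i e : Expr) (σ : Memory) :
      Runs (.store a i e) σ (σ.set a (i.eval σ) (e.eval σ)) (1 + i.cost + e.cost)
  | seq {p₁ p₂ : Prog} {σ σ₁ σ₂ : Memory} {T₁ T₂ : ℕ} :
      Runs p₁ σ σ₁ T₁ → Runs p₂ σ₁ σ₂ T₂ → Runs (.seq p₁ p₂) σ σ₂ (T₁ + T₂)
  | ite_true {b : Expr} {p₁ p₂ : Prog} {σ σ' : Memory} {T : ℕ} :
      b.eval σ ≠ 0 → Runs p₁ σ σ' T → Runs (.ite b p₁ p₂) σ σ' (1 + b.cost + T)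
  | ite_false {b : Expr} {p₁ p₂ : Prog} {σ σ' : Memory} {T : ℕ} :
      b.eval σ = 0 → Runs p₂ σ σ' T → Runs (.ite b p₁ p₂) σ σ' (1 + b.cost + T)
  | loop_done {b : Expr} {p : Prog} {σ : Memory} :
      b.eval σ = 0 → Runs (.loop b p) σ σ (1 + b.cost)
  | loop_step {b : Expr} {p : Prog} {σ σ₁ σ₂ : Memory} {T₁ T₂ : ℕ} :
      b.eval σ ≠ 0 → Runs p σ σ₁ T₁ → Runs (.loop b p) σ₁ σ₂ T₂ →
      Runs (.loop b p) σ σ₂ (1 + b.cost + T₁ + T₂)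

/-- The machine is deterministic: a program and an initial memory determine the final memory
and the number of steps. -/
theorem Runs.deterministic {p : Prog} {σ σ₁ σ₂ : Memory} {T₁ T₂ : ℕ}
    (h₁ : Runs p σ σ₁ T₁) (h₂ : Runs p σ σ₂ T₂) : σ₁ = σ₂ ∧ T₁ = T₂ := by
  induction h₁ generalizing σ₂ T₂ with
  | skip σ => cases h₂; exact ⟨rfl, rfl⟩
  | store a i e σ => cases h₂; exact ⟨rfl, rfl⟩
  | seq _ _ ih₁ ih₂ =>
    cases h₂ with
    | seq k₁ k₂ =>
      obtain ⟨rfl, rfl⟩ := ih₁ k₁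
      obtain ⟨rfl, rfl⟩ := ih₂ k₂
      exact ⟨rfl, rfl⟩
  | ite_true hb _ ih =>
    cases h₂ with
    | ite_true _ k => obtain ⟨rfl, rfl⟩ := ih k; exact ⟨rfl, rfl⟩
    | ite_false hb' _ => exact absurd hb' hb
  | ite_false hb _ ih =>
    cases h₂ with
    | ite_true hb' _ => exact absurd hb hb'
    | ite_false _ k => obtain ⟨rfl, rfl⟩ := ih k; exact ⟨rfl, rfl⟩
  | loop_done hb =>
    cases h₂ with
    | loop_done _ => exact ⟨rfl, rfl⟩
    | loop_step hb' _ _ => exact absurd hb hb'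
  | loop_step hb _ _ ih₁ ih₂ =>
    cases h₂ with
    | loop_done hb' => exact absurd hb' hb
    | loop_step _ k₁ k₂ =>
      obtain ⟨rfl, rfl⟩ := ih₁ k₁
      obtain ⟨rfl, rfl⟩ := ih₂ k₂
      exact ⟨rfl, rfl⟩

/-! ### Graphs, faults and shortest paths -/

/-- The path `p` of `G` is a shortest path in `G ∖ S`: it uses no edge of `S`, and no walk of
`G ∖ S` between its endpoints is shorter. -/
def IsShortestPathAvoiding {V : Type*} {G : SimpleGraph V} {u v : V} (p : G.Walk u v)
    (S : Set (Sym2 V)) : Prop :=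
  p.IsPath ∧ (∀ e ∈ p.edges, e ∉ S) ∧
    ∀ w : (G.deleteEdges S).Walk u v, p.length ≤ w.length

/-- The part of the walk `p` from its vertex number `a` to its vertex number `b`, counted from
`0`, for `a ≤ b ≤ p.length`. -/
def subwalk {V : Type*} {G : SimpleGraph V} {u v : V} (p : G.Walk u v) (a b : ℕ) :
    G.Walk (p.getVert a) ((p.drop a).getVert (b - a)) :=
  (p.drop a).take (b - a)

/-- The list `L` enumerates the edges in `F`, each of them once, in any order and in any
orientation. -/
def Enumerates {V : Type*} (L : List (V × V)) (F : Finset (Sym2 V)) : Prop :=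
  (L.map fun e => s(e.1, e.2)).Nodup ∧ ∀ e, e ∈ F ↔ e ∈ L.map fun e => s(e.1, e.2)

/-! ### Input and output of the machine -/

/-- The input memory, for a graph `G` with vertices `0, …, n - 1`, the list `L` of the faults,
a path `p` and a number `k`:

* array `0` holds `n`, the number of faults, `k` and the length of `p`;
* array `1` holds the adjacency matrix of `G`, row by row;
* arrays `2` and `3` hold the first and second endpoints of the faults;
* array `4` holds the vertices of `p` in their order on `p`;
* all other cells hold `0`. -/
noncomputable def inputMemory {n : ℕ} (G : SimpleGraph (Fin n)) (L : List (Fin n × Fin n))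
    {s t : Fin n} (p : G.Walk s t) (k : ℕ) : Memory :=
  open Classical in
  fun a i =>
    match a with
    | 0 => [n, L.length, k, p.length].getD i 0
    | 1 => if ∃ u v : Fin n, i = (u : ℕ) * n + (v : ℕ) ∧ G.Adj u v then 1 else 0
    | 2 => (L.map fun e => (e.1 : ℕ)).getD i 0
    | 3 => (L.map fun e => (e.2 : ℕ)).getD i 0
    | 4 => (p.support.map fun v => (v : ℕ)).getD i 0
    | _ => 0

/-- Output: the number of subpaths, in cell `0` of array `5`. -/
def outCount (σ : Memory) : ℕ := σ 5 0

/-- Output: the `i`-th boundary between subpaths, as a position on the input path, in cell `i`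
of array `6`. -/
def outBoundary (σ : Memory) (i : ℕ) : ℕ := σ 6 i

/-- Output: the `i`-th fault set, as a bit vector over the list `L` of all faults; it is row `i`
of a matrix with `L.length` columns, stored row by row in array `7`. -/
def outFaults {n : ℕ} (L : List (Fin n × Fin n)) (σ : Memory) (i : ℕ) :
    Finset (Sym2 (Fin n)) :=
  ((Finset.univ : Finset (Fin L.length)).filter fun j : Fin L.length => σ 7 (i * L.length + (j : ℕ)) ≠ 0).image
    fun j => s((L.get j).1, (L.get j).2)

end PathRestoration

open PathRestoration

namespace PathRestoration

/-! ### Total correctness with a time bound -/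

/-! Let `l` be the length of `π`, and give each vertex the potential `max (0, l - dist)`, where
`dist` is its distance to the end of `π` in `G ∖ F`. It changes by at most 1 along each edge of `G ∖
F`, and vertex number `i` of `π` has potential `i`. Hence every fault endpoint gets a place on the
line on which `π` lives.

Choose cut points on this line with at most `f / (2k)` fault endpoints in the open interval between
consecutive ones, and split `π` halfway between consecutive cut points. A piece from `a` to `b` then
belongs to a cut point `q` with neighbours `g` and `p`: up to rounding, `a` is at least the middle
of `g` and `q`, and `b` is at most the middle of `q` and `p`. Its fault set consists of the faults
with an endpoint in `(g, q)` or `(q, p)`, at most `f / k` of them.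

A walk from `a` to `b` without faults has length at least `b - a`. One that uses a fault outside the
fault set must visit potentials outside both intervals. Reaching the first from `a` costs at least
`q - a - 1`, returning from the last to `b` costs at least `b - q`, and the fault edge costs 1;
again the sum is at least `b - a` (`walk_potential`, `isShortestPathAvoiding_subwalk`).

The cuts are greedy. The `2f` endpoints weigh `2k` each, and every cut but the last uses up weight
at least `f + 1`, which leaves at most `4k` pieces (`ensures_scanStep`, `ScanInv.count_le`).
Endpoints on a cut point lie in no open interval, so a crowded potential does no harm. The potential
comes from Bellman-Ford relaxation (`ensures_potential`). -/

theorem Memory.set_of_ne {σ : Memory} {a b i v : ℕ} (h : b ≠ a) : σ.set a i v b = σ b := by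
  simp [Memory.set, h]

theorem Memory.set_self {σ : Memory} {a i v : ℕ} :
    σ.set a i v a = Function.update (σ a) i v := by
  simp [Memory.set]

/-- Started with memory `σ`, the program `p` halts within `T` steps with a memory satisfying
`Q`. -/
def Ensures (p : Prog) (σ : Memory) (T : ℕ) (Q : Memory → Prop) : Prop :=
  ∃ σ' T', Runs p σ σ' T' ∧ T' ≤ T ∧ Q σ'

theorem Ensures.mono {p : Prog} {σ : Memory} {T T' : ℕ} {Q Q' : Memory → Prop}
    (h : Ensures p σ T Q) (hT : T ≤ T') (hQ : ∀ τ, Q τ → Q' τ) : Ensures p σ T' Q' := by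
  obtain ⟨τ, t, hr, ht, hq⟩ := h
  exact ⟨τ, t, hr, ht.trans hT, hQ _ hq⟩

theorem Ensures.skip {σ : Memory} {Q : Memory → Prop} (h : Q σ) : Ensures .skip σ 1 Q :=
  ⟨σ, 1, .skip σ, le_rfl, h⟩

theorem Ensures.store {σ : Memory} {a : ℕ} {i e : Expr} {Q : Memory → Prop}
    (h : Q (σ.set a (i.eval σ) (e.eval σ))) :
    Ensures (.store a i e) σ (1 + i.cost + e.cost) Q :=
  ⟨_, _, .store a i e σ, le_rfl, h⟩

theorem Ensures.seq {p₁ p₂ : Prog} {σ : Memory} {T₁ T₂ : ℕ} {R Q : Memory → Prop}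
    (h₁ : Ensures p₁ σ T₁ R) (h₂ : ∀ τ, R τ → Ensures p₂ τ T₂ Q) :
    Ensures (.seq p₁ p₂) σ (T₁ + T₂) Q := by
  obtain ⟨τ, t, hr, ht, hq⟩ := h₁
  obtain ⟨τ', t', hr', ht', hq'⟩ := h₂ τ hq
  exact ⟨τ', _, .seq hr hr', add_le_add ht ht', hq'⟩

theorem Ensures.store_seq {σ : Memory} {a : ℕ} {i e : Expr} {p : Prog} {T : ℕ}
    {Q : Memory → Prop} (h : Ensures p (σ.set a (i.eval σ) (e.eval σ)) T Q) :
    Ensures (.seq (.store a i e) p) σ (1 + i.cost + e.cost + T) Q :=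
  .seq (R := fun τ => τ = σ.set a (i.eval σ) (e.eval σ)) (.store rfl) (by rintro _ rfl; exact h)

theorem Ensures.ite {b : Expr} {p₁ p₂ : Prog} {σ : Memory} {T : ℕ} {Q : Memory → Prop}
    (h₁ : b.eval σ ≠ 0 → Ensures p₁ σ T Q) (h₂ : b.eval σ = 0 → Ensures p₂ σ T Q) :
    Ensures (.ite b p₁ p₂) σ (1 + b.cost + T) Q := by
  by_cases hb : b.eval σ = 0
  · obtain ⟨τ, t, hr, ht, hq⟩ := h₂ hb
    exact ⟨τ, _, .ite_false hb hr, by omega, hq⟩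
  · obtain ⟨τ, t, hr, ht, hq⟩ := h₁ hb
    exact ⟨τ, _, .ite_true hb hr, by omega, hq⟩

/-- Loops whose number of iterations is bounded by the variant `m`. -/
theorem Ensures.loop {b : Expr} {p : Prog} {T : ℕ} {I : Memory → Prop} {m : Memory → ℕ}
    (hstep : ∀ τ, I τ → b.eval τ ≠ 0 → Ensures p τ T fun τ' => I τ' ∧ m τ' < m τ) {M : ℕ} :
    ∀ {σ : Memory}, I σ → m σ ≤ M →
      Ensures (.loop b p) σ (M * (T + b.cost + 1) + b.cost + 1)
        fun τ => I τ ∧ b.eval τ = 0 := by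
  induction M with
  | zero =>
    intro σ hI hm
    by_cases hb : b.eval σ = 0
    · exact ⟨σ, _, .loop_done hb, by omega, hI, hb⟩
    · obtain ⟨τ, t, -, -, -, hlt⟩ := hstep σ hI hb
      omega
  | succ M ih =>
    intro σ hI hm
    by_cases hb : b.eval σ = 0
    · exact ⟨σ, _, .loop_done hb, by ring_nf; omega, hI, hb⟩
    · obtain ⟨τ, t, hr, ht, hI', hlt⟩ := hstep σ hI hb
      obtain ⟨τ', t', hr', ht', hq⟩ := ih hI' (by omega)
      exact ⟨τ', _, .loop_step hb hr hr', by rw [Nat.add_mul]; omega, hq⟩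

/-- The value of a scalar variable, kept in cell `0` of an array. -/
abbrev Expr.var (a : ℕ) : Expr := .get a (.lit 0)

/-- Repeat `p` with the variable `c` running through `0, …, N - 1`. -/
def Prog.forLoop (c : ℕ) (N : Expr) (p : Prog) : Prog :=
  .seq (.store c (.lit 0) (.lit 0))
    (.loop (.sub N (.var c)) (.seq p (.store c (.lit 0) (.add (.var c) (.lit 1)))))

/-- The invariant has to survive writes to the counter (`hc`), and the body has to leave the counter
at its value. The bound `N` is evaluated anew in each test, so the invariant must also fix its
value. -/
theorem Ensures.forLoop {c : ℕ} {N : Expr} {p : Prog} {T M : ℕ} (I : ℕ → Memory → Prop)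
    {σ : Memory} (h0 : I 0 σ) (hN : ∀ i τ, I i τ → N.eval τ = M)
    (hc : ∀ i τ x, I i τ → I i (τ.set c 0 x))
    (hstep : ∀ i τ, i < M → I i τ → τ c 0 = i →
      Ensures p τ T fun τ' => τ' c 0 = i ∧ I (i + 1) τ') :
    Ensures (.forLoop c N p) σ (M * (T + N.cost + 10) + N.cost + 10) (I M) := by
  have key := Ensures.loop (b := .sub N (.var c))
    (p := .seq p (.store c (.lit 0) (.add (.var c) (.lit 1)))) (T := T + 6)
    (I := fun τ => I (τ c 0) τ ∧ τ c 0 ≤ M) (m := fun τ => M - τ c 0)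
    (fun τ ⟨hI, hle⟩ hb => by
      simp only [Expr.eval, hN _ _ hI] at hb
      refine Ensures.seq (hstep _ τ (by omega) hI rfl) fun τ' ⟨h1, h2⟩ => ?_
      refine Ensures.store ?_
      simp only [Expr.eval, h1, Memory.set_self, Function.update_self]
      exact ⟨⟨hc _ _ _ h2, by omega⟩, by omega⟩) (M := M)
    (σ := σ.set c 0 0) (by simpa [Memory.set_self] using hc _ _ 0 h0) (by simp)
  refine (Ensures.store_seq (T := M * (T + N.cost + 10) + N.cost + 4) ?_).mono
    (by simp only [Expr.cost]; omega) fun _ h => h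
  refine key.mono ?_ fun τ ⟨⟨hI, hle⟩, hb⟩ => ?_
  · simp only [Expr.cost]
    have : M * (T + 6 + (1 + N.cost + (1 + 1)) + 1) = M * (T + N.cost + 10) := by ring
    omega
  · simp only [Expr.eval, hN _ _ hI] at hb
    rwa [show τ c 0 = M by omega] at hI

/-- The two memories differ at most in the arrays in `S`. -/
def AgreeOff (S : Finset ℕ) (σ τ : Memory) : Prop := ∀ a ∉ S, τ a = σ a

theorem AgreeOff.refl (S : Finset ℕ) (σ : Memory) : AgreeOff S σ σ := fun _ _ => rfl

theorem AgreeOff.trans {S : Finset ℕ} {σ τ υ : Memory} (h : AgreeOff S σ τ)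
    (h' : AgreeOff S τ υ) : AgreeOff S σ υ := fun a ha => (h' a ha).trans (h a ha)

theorem AgreeOff.mono {S S' : Finset ℕ} {σ τ : Memory} (h : AgreeOff S σ τ) (hS : S ⊆ S') :
    AgreeOff S' σ τ := fun a ha => h a fun ha' => ha (hS ha')

theorem AgreeOff.set {S : Finset ℕ} {σ τ : Memory} (h : AgreeOff S σ τ) {a : ℕ} (ha : a ∈ S)
    (i v : ℕ) : AgreeOff S σ (τ.set a i v) := fun b hb => by
  rw [Memory.set_of_ne (by rintro rfl; exact hb ha)]
  exact h b hb

/-! ### Walks and the potential of the path -/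

section Potential

variable {V : Type*} {G : SimpleGraph V} {F S : Set (Sym2 V)} {y : V → ℕ}

/-- A walk either avoids all faults, or it runs from its start to an endpoint of a fault outside
`S` and from another such endpoint to its end. -/
theorem walk_potential (hy : ∀ u v, (G.deleteEdges F).Adj u v → y u ≤ y v + 1)
    {Z : ℕ → Prop} (hZ : ∀ u v, s(u, v) ∈ F → s(u, v) ∉ S → Z (y u)) {u v : V}
    (w : (G.deleteEdges S).Walk u v) :
    (y u ≤ y v + w.length ∧ y v ≤ y u + w.length) ∨
      ∃ x x' c d, Z x ∧ Z x' ∧ y u ≤ x + c ∧ x ≤ y u + c ∧ y v ≤ x' + d ∧ x' ≤ y v + d ∧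
        c + d + 1 ≤ w.length := by
  induction w with
  | nil => left; simp
  | @cons u u' v h w ih =>
    rw [SimpleGraph.deleteEdges_adj] at h
    rw [SimpleGraph.Walk.length_cons]
    by_cases hF : s(u, u') ∈ F
    · right
      have h1 := hZ u u' hF h.2
      have h2 := hZ u' u (by rwa [Sym2.eq_swap]) (by rw [Sym2.eq_swap]; exact h.2)
      rcases ih with ih | ⟨x, x', c, d, hx, hx', i1, i2, i3, i4, i5⟩
      -- The first edge is the only fault met: its endpoints serve as `x` and `x'`, and the edge
      -- itself is the `+ 1` in the length.
      · exact ⟨y u, y u', 0, w.length, h1, h2, by omega⟩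
      · exact ⟨y u, x', 0, d, h1, hx', by omega⟩
    · have hadj : (G.deleteEdges F).Adj u u' := SimpleGraph.deleteEdges_adj.2 ⟨h.1, hF⟩
      have e1 := hy _ _ hadj
      have e2 := hy _ _ hadj.symm
      rcases ih with ih | ⟨x, x', c, d, hx, hx', i1, i2, i3, i4, i5⟩
      · left; omega
      · exact .inr ⟨x, x', c + 1, d, hx, hx', by omega⟩

/-- `z` lies in one of the open intervals `(g, q)` and `(q, p)`. -/
def InGaps (g q p z : ℕ) : Prop := (g < z ∧ z < q) ∨ (q < z ∧ z < p)

/-- Midpoints are optimal here: from `a` it is at least as far to `g` as to `q`, up to one unit, and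
from `b` at least as far to `p` as to `q`. The unit lost by rounding is regained by the fault edge.
The alternative `a = b` is needed where the end of the path stops the boundary short of the middle.
-/
theorem isShortestPathAvoiding_subwalk {s t : V} {π : G.Walk s t}
    (hπ : IsShortestPathAvoiding π F)
    (hy : ∀ u v, (G.deleteEdges F).Adj u v → y u ≤ y v + 1)
    (hyπ : ∀ i ≤ π.length, y (π.getVert i) = i) (hS : S ⊆ F) {a b g q p : ℕ}
    (hab : a ≤ b) (hb : b ≤ π.length) (hga : a = b ∨ g + q ≤ 2 * a + 1) (hbq : 2 * b ≤ q + p)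
    (hgap : ∀ u v, s(u, v) ∈ F → s(u, v) ∉ S → ¬ InGaps g q p (y u)) :
    IsShortestPathAvoiding (subwalk π a b) S := by
  refine ⟨(hπ.1.drop a).take _, fun e he heS => ?_, fun w => ?_⟩
  · refine hπ.2.1 e ?_ (hS heS)
    have h1 : e ∈ ((π.drop a).take (b - a)).edges := he
    exact (π.isSubwalk_drop a).edges_subset (((π.drop a).isSubwalk_take _).edges_subset h1)
  · have hlen : (subwalk π a b).length ≤ b - a := by
      simp [subwalk, SimpleGraph.Walk.take_length]
    have hya := hyπ a (by omega)
    have hyb : y ((π.drop a).getVert (b - a)) = b := by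
      rw [SimpleGraph.Walk.drop_getVert, show a + (b - a) = b by omega]
      exact hyπ b hb
    refine hlen.trans ?_
    rcases walk_potential hy (Z := fun z => ¬ InGaps g q p z) hgap w with
      h | ⟨x, x', c, d, hx, hx', i1, i2, i3, i4, i5⟩
    · omega
    -- As `x` is not in `(g, q)`, `c + 1 ≥ q - a`; as `x'` is not in `(q, p)`, `d ≥ b - q`.
    · rw [hya] at i1 i2
      rw [hyb] at i3 i4
      simp only [InGaps] at hx hx'
      omega

end Potential

/-! ### Deleting the faults from the adjacency matrix -/

/-- The number of vertices. -/
abbrev Expr.order : Expr := .get 0 (.lit 0)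
/-- The number of faults. -/
abbrev Expr.faults : Expr := .get 0 (.lit 1)
/-- The parameter `k`. -/
abbrev Expr.param : Expr := .get 0 (.lit 2)
/-- The length of the path. -/
abbrev Expr.len : Expr := .get 0 (.lit 3)

/-- Write the multiples of the number of vertices into array `8`. -/
def Prog.rowOffsets : Prog :=
  .forLoop 10 .order (.store 8 (.add (.var 10) (.lit 1)) (.add (.get 8 (.var 10)) .order))

/-- The machine cannot multiply in one step; this table makes the matrix addressable. -/
theorem ensures_rowOffsets {σ : Memory} {n : ℕ} (hn : σ 0 0 = n) (h8 : σ 8 0 = 0) :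
    Ensures .rowOffsets σ (n * 30 + 30)
      fun τ => AgreeOff {8, 10} σ τ ∧ ∀ i ≤ n, τ 8 i = i * n := by
  refine (Ensures.forLoop (T := 11) (M := n)
    (fun m τ => AgreeOff {8, 10} σ τ ∧ ∀ i ≤ m, τ 8 i = i * n)
    ⟨.refl _ _, ?_⟩ ?_ ?_ ?_).mono ?_ fun _ h => h
  · rintro i hi
    simp [Nat.le_zero.1 hi, h8]
  · rintro i τ ⟨h, -⟩
    simp [Expr.eval, h 0 (by decide), hn]
  · rintro i τ x ⟨h, h'⟩
    exact ⟨h.set (by decide) _ _, by simpa [Memory.set_of_ne] using h'⟩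
  · rintro i τ hi ⟨h, h'⟩ hc
    refine (Ensures.store ?_).mono (by simp [Expr.cost]) fun _ h => h
    simp only [Expr.eval, hc, h 0 (by decide), hn, h' i le_rfl]
    refine ⟨by simp [Memory.set_of_ne, hc], h.set (by decide) _ _, fun j hj => ?_⟩
    rw [Memory.set_self]
    by_cases hji : j = i + 1
    · subst hji
      simp [Nat.add_mul]
    · rw [Function.update_of_ne hji]
      exact h' j (by omega)
  · simp only [Expr.cost]; omega

/-- Write `0` into the entries of the adjacency matrix that belong to a fault. -/
def Prog.deleteFaults : Prog :=
  .forLoop 10 .faults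
    (.seq
      (.store 1 (.add (.get 8 (.get 2 (.var 10))) (.get 3 (.var 10))) (.lit 0))
      (.store 1 (.add (.get 8 (.get 3 (.var 10))) (.get 2 (.var 10))) (.lit 0)))

theorem ensures_deleteFaults {σ : Memory} {n f : ℕ} {e₁ e₂ : ℕ → ℕ} (hf : σ 0 1 = f)
    (h8 : ∀ i ≤ n, σ 8 i = i * n) (he₁ : ∀ j < f, σ 2 j = e₁ j) (he₂ : ∀ j < f, σ 3 j = e₂ j)
    (hl₁ : ∀ j < f, e₁ j < n) (hl₂ : ∀ j < f, e₂ j < n) :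
    Ensures .deleteFaults σ (f * 40 + 40) fun τ => AgreeOff {1, 10} σ τ ∧
      ∀ x, τ 1 x ≠ 0 ↔ σ 1 x ≠ 0 ∧ ∀ j < f, x ≠ e₁ j * n + e₂ j ∧ x ≠ e₂ j * n + e₁ j := by
  refine (Ensures.forLoop (T := 28) (M := f) (fun m τ => AgreeOff {1, 10} σ τ ∧
      ∀ x, τ 1 x ≠ 0 ↔ σ 1 x ≠ 0 ∧ ∀ j < m, x ≠ e₁ j * n + e₂ j ∧ x ≠ e₂ j * n + e₁ j)
    ⟨.refl _ _, by simp⟩ ?_ ?_ ?_).mono ?_ fun _ h => h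
  · rintro i τ ⟨h, -⟩
    simp [Expr.eval, h 0 (by decide), hf]
  · rintro i τ x ⟨h, h'⟩
    exact ⟨h.set (by decide) _ _, by simpa [Memory.set_of_ne] using h'⟩
  · rintro i τ hi ⟨h, h'⟩ hc
    refine (Ensures.store_seq (Ensures.store ?_)).mono (by simp [Expr.cost]) fun _ h => h
    simp only [Expr.eval, Memory.set_of_ne (show (2 : ℕ) ≠ 1 by decide),
      Memory.set_of_ne (show (3 : ℕ) ≠ 1 by decide), Memory.set_of_ne (show (8 : ℕ) ≠ 1 by decide),
      Memory.set_of_ne (show (10 : ℕ) ≠ 1 by decide), hc, h 2 (by decide), h 3 (by decide),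
      h 8 (by decide), he₁ i hi, he₂ i hi, h8 _ (hl₁ i hi).le, h8 _ (hl₂ i hi).le]
    refine ⟨by simp, (h.set (by decide) _ _).set (by decide) _ _,
      fun x => ?_⟩
    simp only [Memory.set_self, Function.update_apply, Nat.forall_lt_succ_right]
    split_ifs with h1 h2
    · simp [h1]
    · simp [h2]
    · rw [h' x]
      tauto
  · simp only [Expr.cost]; omega

/-! ### The potential -/

/-- Compute in array `9` the potential of the vertices, which is the truncated difference between
the length of the path and the distance to its end. -/
def Prog.potential : Prog :=
  .seq (.store 9 (.get 4 .len) .len)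
    (.forLoop 10 .len (.forLoop 11 .order (.forLoop 12 .order
      (.ite (.get 1 (.add (.get 8 (.var 11)) (.var 12)))
        (.store 9 (.var 12) (.add (.get 9 (.var 12))
          (.sub (.sub (.get 9 (.var 11)) (.lit 1)) (.get 9 (.var 12)))))
        .skip))))

section Potential

variable {n : ℕ} {H : SimpleGraph (Fin n)} {t : Fin n} {l : ℕ}

/-- A positive potential is witnessed by a walk to `t`. -/
def PotSound (H : SimpleGraph (Fin n)) (t : Fin n) (l : ℕ) (y : ℕ → ℕ) : Prop :=
  ∀ v : Fin n, y v ≠ 0 → ∃ w : H.Walk v t, w.length + y v ≤ l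

/-- The potential is large enough for all walks to `t` of length at most `r`. -/
def PotFull (H : SimpleGraph (Fin n)) (t : Fin n) (l r : ℕ) (y : ℕ → ℕ) : Prop :=
  ∀ (v : Fin n) (w : H.Walk v t), w.length ≤ r → l ≤ y v + w.length

/-- The potential is large enough for all walks to `t` of length at most `r + 1` whose first edge
goes from `z` to `x`, where `(x, z)` is lexicographically smaller than `(u, v)`. -/
def PotPart (H : SimpleGraph (Fin n)) (t : Fin n) (l r u v : ℕ) (y : ℕ → ℕ) : Prop :=
  ∀ (x z : Fin n) (w : H.Walk x t), w.length ≤ r → H.Adj x z →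
    ((x : ℕ) < u ∨ (x : ℕ) = u ∧ (z : ℕ) < v) → l ≤ y z + w.length + 1

theorem PotFull.mono {r : ℕ} {y y' : ℕ → ℕ} (h : PotFull H t l r y) (hy : y ≤ y') :
    PotFull H t l r y' := fun v w hw => (h v w hw).trans (Nat.add_le_add_right (hy _) _)

theorem PotPart.mono {r u v : ℕ} {y y' : ℕ → ℕ} (h : PotPart H t l r u v y) (hy : y ≤ y') :
    PotPart H t l r u v y' := fun x z w hw hxz hlt => by
  have := h x z w hw hxz hlt
  have : y z ≤ y' z := hy z
  omega

theorem PotFull.succ {r : ℕ} {y : ℕ → ℕ} (h : PotFull H t l r y) (h' : PotPart H t l r n 0 y) :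
    PotFull H t l (r + 1) y := by
  intro v w hw
  cases w with
  | nil => exact h _ .nil (by simp)
  | @cons _ x _ hadj w =>
    rw [SimpleGraph.Walk.length_cons] at hw ⊢
    exact h' x v w (by omega) hadj.symm (.inl x.2)

/-- This is Bellman-Ford in place: round `r` may already use values raised in the same round. So the
invariant gives no exact values after `r` rounds, only the upper bound `PotSound` and the lower
bound `PotFull`, with `PotPart` recording the arcs relaxed so far. -/
theorem ensures_potential {σ : Memory} (hn : σ 0 0 = n) (hl : σ 0 3 = l) (ht : σ 4 l = t)
    (h8 : ∀ i ≤ n, σ 8 i = i * n) (h9 : ∀ i, σ 9 i = 0)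
    (hH : ∀ u v : Fin n, σ 1 (u * n + v) ≠ 0 ↔ H.Adj u v) :
    Ensures .potential σ (l * (n * (n * 60 + 60) + 60) + 60) fun τ =>
      AgreeOff {9, 10, 11, 12} σ τ ∧ PotSound H t l (τ 9) ∧ PotFull H t l l (τ 9) := by
  let S : Finset ℕ := {9, 10, 11, 12}
  have hset : ∀ (c : ℕ) (hc : c ∈ ({10, 11, 12} : Finset ℕ)) (y : ℕ → ℕ) (τ : Memory) (x : ℕ),
      AgreeOff S σ τ ∧ τ 9 = y → AgreeOff S σ (τ.set c 0 x) ∧ τ.set c 0 x 9 = y := by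
    rintro c hc y τ x ⟨h, rfl⟩
    refine ⟨h.set (Finset.mem_insert_of_mem hc) _ _, Memory.set_of_ne ?_⟩
    rintro rfl
    revert hc
    decide
  refine (Ensures.store_seq (T := l * (n * (n * 60 + 60) + 60) + 30)
    ((Ensures.forLoop (T := n * (n * 60 + 60) + 20) (M := l)
    (fun r τ => AgreeOff S σ τ ∧ PotSound H t l (τ 9) ∧ PotFull H t l r (τ 9))
    ?_ ?_ ?_ ?_).mono ?_ fun _ h => h)).mono ?_ fun _ h => h
  · simp only [Expr.eval, hl, ht]
    refine ⟨(AgreeOff.refl _ _).set (by decide) _ _, fun v hv => ?_, fun v w hw => ?_⟩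
    · rw [Memory.set_self, Function.update_apply] at hv ⊢
      by_cases hvt : v = t
      · subst hvt
        exact ⟨.nil, by simp⟩
      · have : (v : ℕ) ≠ t := fun h => hvt (Fin.ext h)
        simp [this, h9] at hv
    · obtain rfl := SimpleGraph.Walk.eq_of_length_eq_zero (Nat.le_zero.1 hw)
      simp [Memory.set_self]
  · rintro i τ ⟨h, -⟩
    simp [Expr.eval, h 0 (by decide), hl]
  · rintro i τ x ⟨h, h'⟩
    obtain ⟨h1, h2⟩ := hset 10 (by decide) _ τ x ⟨h, rfl⟩
    rw [h2]
    exact ⟨h1, h'⟩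
  · rintro r τ₀ - ⟨hσ₀, hs₀, hf₀⟩ hc
    refine (Ensures.forLoop (T := n * 60 + 30) (M := n)
      (fun u τ => AgreeOff S σ τ ∧ τ 10 0 = r ∧ PotSound H t l (τ 9) ∧ PotFull H t l r (τ 9) ∧
        PotPart H t l r u 0 (τ 9)) ⟨hσ₀, hc, hs₀, hf₀, ?_⟩ ?_ ?_ ?_).mono ?_
      fun τ ⟨g1, g2, g3, g4, g5⟩ => ⟨g2, g1, g3, g4.succ g5⟩
    · intro x z w _ _ hlt
      omega
    · rintro i τ ⟨h, -⟩
      simp [Expr.eval, h 0 (by decide), hn]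
    · rintro i τ x ⟨h, h10, h'⟩
      obtain ⟨h1, h2⟩ := hset 11 (by decide) _ τ x ⟨h, rfl⟩
      rw [h2]
      exact ⟨h1, by simpa [Memory.set_of_ne] using h10, h'⟩
    · rintro u τ₁ hu ⟨hσ₁, h10₁, hs₁, hf₁, hp₁⟩ hc₁
      refine (Ensures.forLoop (T := 45) (M := n)
        (fun v τ => AgreeOff S σ τ ∧ τ 10 0 = r ∧ τ 11 0 = u ∧ PotSound H t l (τ 9) ∧
          PotFull H t l r (τ 9) ∧ PotPart H t l r u v (τ 9))
        ⟨hσ₁, h10₁, hc₁, hs₁, hf₁, hp₁⟩ ?_ ?_ ?_).mono ?_ ?_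
      · rintro i τ ⟨h, -⟩
        simp [Expr.eval, h 0 (by decide), hn]
      · rintro i τ x ⟨h, h10, h11, h'⟩
        obtain ⟨h1, h2⟩ := hset 12 (by decide) _ τ x ⟨h, rfl⟩
        rw [h2]
        exact ⟨h1, by simpa [Memory.set_of_ne] using h10, by simpa [Memory.set_of_ne] using h11,
          h'⟩
      · rintro v τ hv ⟨hσ, h10, h11, hs, hf, hp⟩ hc₂
        have hadj := hH ⟨u, hu⟩ ⟨v, hv⟩
        refine (Ensures.ite (T := 30) (fun hb => ?_) fun hb => ?_).mono (by simp [Expr.cost])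
          fun _ h => h
        · simp only [Expr.eval, hσ 1 (by decide), hσ 8 (by decide), h11, hc₂, h8 u hu.le] at hb
          replace hadj := hadj.1 hb
          refine (Ensures.store ?_).mono (by simp [Expr.cost]) fun _ h => h
          simp only [Expr.eval, h11, hc₂]
          have hle : τ 9 ≤ Function.update (τ 9) v (τ 9 v + (τ 9 u - 1 - τ 9 v)) := by
            intro x
            rw [Function.update_apply]
            split_ifs with hx
            · subst hx
              exact Nat.le_add_right _ _
            · rfl
          rw [Memory.set_self]
          refine ⟨by simpa [Memory.set_of_ne] using hc₂, hσ.set (by decide) _ _,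
            by simpa [Memory.set_of_ne] using h10, by simpa [Memory.set_of_ne] using h11,
            fun x hx => ?_, hf.mono hle, fun x z w hw hxz hlt => ?_⟩
          · rw [Function.update_apply] at hx ⊢
            split_ifs at hx ⊢ with hxv
            · obtain rfl : x = ⟨v, hv⟩ := Fin.ext hxv
              -- A zero increment keeps the old walk of `v`; otherwise the new value is `τ 9 u - 1`,
              -- witnessed by the walk of `u` with the arc put in front.
              by_cases hcase : τ 9 u - 1 - τ 9 v = 0
              · obtain ⟨w, hw⟩ := hs ⟨v, hv⟩ (by simpa [hcase] using hx)
                exact ⟨w, by simpa [hcase] using hw⟩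
              · obtain ⟨w, hw⟩ := hs ⟨u, hu⟩ (by simp only; omega)
                refine ⟨.cons hadj.symm w, ?_⟩
                rw [SimpleGraph.Walk.length_cons]
                simp only at hw
                omega
            · exact hs x hx
          · by_cases hold : (x : ℕ) < u ∨ (x : ℕ) = u ∧ (z : ℕ) < v
            · exact hp.mono hle x z w hw hxz hold
            · have hxu : (x : ℕ) = u := by omega
              have hzv : (z : ℕ) = v := by omega
              obtain rfl : x = ⟨u, hu⟩ := Fin.ext hxu
              obtain rfl : z = ⟨v, hv⟩ := Fin.ext hzv
              have := hf _ w hw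
              simp only [Function.update_self] at this ⊢
              omega
        · simp only [Expr.eval, hσ 1 (by decide), hσ 8 (by decide), h11, hc₂, h8 u hu.le] at hb
          replace hadj : ¬ H.Adj ⟨u, hu⟩ ⟨v, hv⟩ := fun h => hadj.2 h hb
          refine (Ensures.skip ?_).mono (by norm_num) fun _ h => h
          refine ⟨hc₂, hσ, h10, h11, hs, hf, fun x z w hw hxz hlt => ?_⟩
          by_cases hold : (x : ℕ) < u ∨ (x : ℕ) = u ∧ (z : ℕ) < v
          · exact hp x z w hw hxz hold
          · have hxu : (x : ℕ) = u := by omega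
            have hzv : (z : ℕ) = v := by omega
            obtain rfl : x = ⟨u, hu⟩ := Fin.ext hxu
            obtain rfl : z = ⟨v, hv⟩ := Fin.ext hzv
            exact absurd hxz hadj
      · simp only [Expr.cost]; omega
      · rintro τ ⟨g1, g2, g3, g4, g5, g6⟩
        refine ⟨g3, g1, g2, g4, g5, fun x z w hw hxz hlt => g6 x z w hw hxz ?_⟩
        have := z.2
        omega
    · simp only [Expr.cost]
      have : n * (n * 60 + 30 + (1 + 1) + 10) ≤ n * (n * 60 + 60) :=
        Nat.mul_le_mul_left _ (by omega)
      omega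
  · simp only [Expr.cost]
    have : l * (n * (n * 60 + 60) + 20 + (1 + 1) + 10) ≤ l * (n * (n * 60 + 60) + 60) :=
        Nat.mul_le_mul_left _ (by omega)
    omega
  · simp only [Expr.cost]; omega

/-- The walk that witnesses a positive `y u`, extended to `v`, still has length at most `l`, so it
bounds `y v` from below. -/
theorem PotFull.le_add_one {y : ℕ → ℕ} (hs : PotSound H t l y) (hf : PotFull H t l l y)
    {u v : Fin n} (h : H.Adj u v) : y u ≤ y v + 1 := by
  by_contra hlt
  obtain ⟨w, hw⟩ := hs u (by omega)
  have := hf v (.cons h.symm w) (by rw [SimpleGraph.Walk.length_cons]; omega)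
  rw [SimpleGraph.Walk.length_cons] at this
  omega

/-- The rest of `π` gives `y ≥ i`. A larger value would come with a walk to `t` that shortcuts `π`
in `G ∖ F`. -/
theorem PotFull.getVert {G : SimpleGraph (Fin n)} {F : Set (Sym2 (Fin n))} {s : Fin n}
    {π : G.Walk s t} (hπ : IsShortestPathAvoiding π F) {y : ℕ → ℕ}
    (hs : PotSound (G.deleteEdges F) t π.length y)
    (hf : PotFull (G.deleteEdges F) t π.length π.length y) {i : ℕ} (hi : i ≤ π.length) :
    y (π.getVert i) = i := by
  have hF : ∀ e ∈ π.edges, e ∈ (G.deleteEdges F).edgeSet := fun e he => by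
    rw [SimpleGraph.edgeSet_deleteEdges]
    exact ⟨π.edges_subset_edgeSet he, hπ.2.1 e he⟩
  let ρ := π.transfer (G.deleteEdges F) hF
  have hρ : ρ.length = π.length := π.length_transfer _
  have hv : ρ.getVert i = π.getVert i := by
    rw [ρ.getVert_eq_support_getElem (by omega), π.getVert_eq_support_getElem hi]
    simp [ρ]
  rw [← hv]
  have hd := hf _ (ρ.drop i) (by rw [SimpleGraph.Walk.drop_length]; omega)
  rw [SimpleGraph.Walk.drop_length] at hd
  by_contra hne
  obtain ⟨w, hw⟩ := hs (ρ.getVert i) (by omega)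
  have := hπ.2.2 ((ρ.take i).append w)
  rw [SimpleGraph.Walk.length_append, SimpleGraph.Walk.take_length] at this
  omega

end Potential

/-! ### Cutting the path into pieces -/

/-- The number of fault endpoints whose potential satisfies `P`, where `z₁` and `z₂` are the
potentials of the first and the second endpoints of the `f` faults. -/
def endpointCount (z₁ z₂ : ℕ → ℕ) (f : ℕ) (P : ℕ → Prop) [DecidablePred P] : ℕ :=
  ((Finset.range f).filter fun j => P (z₁ j)).card +
    ((Finset.range f).filter fun j => P (z₂ j)).card

/-! ### Counting fault endpoints by potential -/

section EndpointCount

variable {z₁ z₂ : ℕ → ℕ} {f : ℕ} {P Q R : ℕ → Prop} [DecidablePred P] [DecidablePred Q]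
  [DecidablePred R]

theorem endpointCount_succ : endpointCount z₁ z₂ (f + 1) P =
    endpointCount z₁ z₂ f P + (if P (z₁ f) then 1 else 0) + (if P (z₂ f) then 1 else 0) := by
  simp only [endpointCount, Finset.range_add_one, Finset.filter_insert]
  split_ifs <;> simp <;> omega

theorem endpointCount_le : endpointCount z₁ z₂ f P ≤ 2 * f := by
  induction f with
  | zero => simp [endpointCount]
  | succ f ih => rw [endpointCount_succ]; split_ifs <;> omega

theorem endpointCount_eq_zero (h : ∀ z, ¬ P z) : endpointCount z₁ z₂ f P = 0 := by
  simp [endpointCount, h]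

theorem endpointCount_le_add (h : ∀ z, P z → Q z ∨ R z) :
    endpointCount z₁ z₂ f P ≤ endpointCount z₁ z₂ f Q + endpointCount z₁ z₂ f R := by
  have key : ∀ z, (if P z then 1 else 0) ≤ (if Q z then 1 else 0) + if R z then 1 else 0 := by
    intro z
    have := h z
    split_ifs <;> simp_all
  induction f with
  | zero => simp [endpointCount]
  | succ f ih =>
    simp only [endpointCount_succ]
    linarith [key (z₁ f), key (z₂ f)]

theorem endpointCount_add_le (hQ : ∀ z, Q z → P z) (hR : ∀ z, R z → P z)
    (hQR : ∀ z, Q z → ¬ R z) :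
    endpointCount z₁ z₂ f Q + endpointCount z₁ z₂ f R ≤ endpointCount z₁ z₂ f P := by
  have key : ∀ z, ((if Q z then 1 else 0) + if R z then 1 else 0) ≤ if P z then 1 else 0 := by
    intro z
    have := hQ z
    have := hR z
    have := hQR z
    split_ifs <;> simp_all
  induction f with
  | zero => simp [endpointCount]
  | succ f ih =>
    simp only [endpointCount_succ]
    linarith [key (z₁ f), key (z₂ f)]

end EndpointCount

/-! ### Program parts for counting, midpoints and fault sets -/

/-- A test for `x ≠ y`. -/
def Expr.ne (x y : Expr) : Expr := .add (.sub x y) (.sub y x)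

/-- The smaller one of two numbers. -/
def Expr.min (x y : Expr) : Expr := .sub x (.sub x y)

theorem Expr.eval_ne {x y : Expr} {σ : Memory} :
    (Expr.ne x y).eval σ = 0 ↔ x.eval σ = y.eval σ := by
  simp only [Expr.ne, Expr.eval]
  omega

theorem Expr.eval_min {x y : Expr} {σ : Memory} :
    (Expr.min x y).eval σ = Min.min (x.eval σ) (y.eval σ) := by
  simp only [Expr.min, Expr.eval]
  omega

/-- The potential of an endpoint of the current fault; `a` is `2` or `3`. -/
abbrev Expr.endpoint (a : ℕ) : Expr := .get 9 (.get a (.var 11))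

/-- Add `2 k` to the accumulator if an endpoint of the current fault has the current potential. -/
def Prog.countEndpoint (a : ℕ) : Prog :=
  .ite (.ne (.endpoint a) (.var 10)) .skip
    (.store 13 (.lit 0) (.add (.var 13) (.add .param .param)))

/-- Add `2 k` to the accumulator for each fault endpoint that has the current potential. -/
def Prog.countEndpoints : Prog :=
  .forLoop 11 .faults (.seq (.countEndpoint 2) (.countEndpoint 3))

theorem ensures_countEndpoint {σ : Memory} {k p z a : ℕ} (hk : σ 0 2 = k) (hp : σ 10 0 = p)
    (hz : σ 9 (σ a (σ 11 0)) = z) :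
    Ensures (.countEndpoint a) σ 40 fun τ => AgreeOff {13} σ τ ∧
      τ 13 0 = σ 13 0 + (k + k) * (if z = p then 1 else 0) := by
  refine (Ensures.ite (T := 10) (fun hb => ?_) fun hb => ?_).mono
    (by simp [Expr.cost, Expr.ne]) fun _ h => h
  · refine (Ensures.skip ?_).mono (by norm_num) fun _ h => h
    rw [Ne, Expr.eval_ne] at hb
    simp only [Expr.eval, hp, hz] at hb
    exact ⟨.refl _ _, by simp [hb]⟩
  · rw [Expr.eval_ne] at hb
    simp only [Expr.eval, hp, hz] at hb
    refine (Ensures.store ?_).mono (by simp [Expr.cost]) fun _ h => h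
    exact ⟨(AgreeOff.refl _ _).set (by decide) _ _,
      by simp [Memory.set_self, hb, Expr.eval, hk]⟩

theorem ensures_countEndpoints {σ : Memory} {f k p : ℕ} {z₁ z₂ : ℕ → ℕ} (hf : σ 0 1 = f)
    (hk : σ 0 2 = k) (hp : σ 10 0 = p) (hz₁ : ∀ j < f, σ 9 (σ 2 j) = z₁ j)
    (hz₂ : ∀ j < f, σ 9 (σ 3 j) = z₂ j) :
    Ensures .countEndpoints σ (f * 100 + 100) fun τ => AgreeOff {11, 13} σ τ ∧
      τ 13 0 = σ 13 0 + (k + k) * endpointCount z₁ z₂ f (· = p) := by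
  refine (Ensures.forLoop (T := 80) (M := f) (fun m τ => AgreeOff {11, 13} σ τ ∧
      τ 13 0 = σ 13 0 + (k + k) * endpointCount z₁ z₂ m (· = p))
    ⟨.refl _ _, by simp [endpointCount]⟩ ?_ ?_ ?_).mono ?_ fun _ h => h
  · rintro i τ ⟨h, -⟩
    simp [Expr.eval, h 0 (by decide), hf]
  · rintro i τ x ⟨h, h'⟩
    exact ⟨h.set (by decide) _ _, by simpa [Memory.set_of_ne] using h'⟩
  · rintro j τ hj ⟨h, h'⟩ hc
    refine (Ensures.seq (T₂ := 40) (ensures_countEndpoint (k := k) (p := p) (z := z₁ j) ?_ ?_ ?_)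
      fun υ ⟨g, g'⟩ => ?_).mono (by norm_num) fun _ h => h
    · rw [h 0 (by decide), hk]
    · rw [h 10 (by decide), hp]
    · rw [h 9 (by decide), h 2 (by decide), hc, hz₁ j hj]
    refine (ensures_countEndpoint (k := k) (p := p) (z := z₂ j) ?_ ?_ ?_).mono le_rfl ?_
    · rw [g 0 (by decide), h 0 (by decide), hk]
    · rw [g 10 (by decide), h 10 (by decide), hp]
    · rw [g 9 (by decide), g 3 (by decide), g 11 (by decide), h 9 (by decide), h 3 (by decide), hc,
        hz₂ j hj]
    · rintro ω ⟨e, e'⟩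
      refine ⟨by rw [e 11 (by decide), g 11 (by decide), hc],
        h.trans ((g.trans e).mono (by decide)), ?_⟩
      rw [e', g', h', endpointCount_succ]
      ring
  · simp only [Expr.cost]; omega

/-- Increase the boundary in variable `14` to the middle between the cut points in the variables
`15` and `10`, or to the end of the path. -/
def Prog.advance : Prog :=
  .loop (.min (.sub .len (.var 14))
      (.sub (.add (.var 15) (.var 10)) (.add (.add (.var 14) (.var 14)) (.lit 1))))
    (.store 14 (.lit 0) (.add (.var 14) (.lit 1)))

/-- Halving is done by counting up: the boundary ends at the rounded-down middle, or at `l` if that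
comes earlier. -/
theorem ensures_advance {σ : Memory} {l q p : ℕ} (hl : σ 0 3 = l) (hq : σ 15 0 = q)
    (hp : σ 10 0 = p) (hb : σ 14 0 ≤ l) (hb' : 2 * σ 14 0 ≤ q + p) :
    Ensures .advance σ (l * 50 + 50) fun τ => AgreeOff {14} σ τ ∧ σ 14 0 ≤ τ 14 0 ∧
      τ 14 0 ≤ l ∧ 2 * τ 14 0 ≤ q + p ∧ (τ 14 0 = l ∨ q + p ≤ 2 * τ 14 0 + 1) := by
  have test : ∀ τ, AgreeOff {14} σ τ → (Expr.min (.sub .len (.var 14)) (.sub (.add (.var 15)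
      (.var 10)) (.add (.add (.var 14) (.var 14)) (.lit 1)))).eval τ =
      Min.min (l - τ 14 0) (q + p - (τ 14 0 + τ 14 0 + 1)) := by
    intro τ h
    rw [Expr.eval_min]
    simp only [Expr.eval, h 0 (by decide), h 15 (by decide), h 10 (by decide), hl, hq, hp]
  refine (Ensures.loop (T := 10)
    (I := fun τ => AgreeOff {14} σ τ ∧ σ 14 0 ≤ τ 14 0 ∧ τ 14 0 ≤ l ∧ 2 * τ 14 0 ≤ q + p)
    (m := fun τ => l - τ 14 0) (M := l) ?_ ⟨.refl _ _, le_rfl, hb, hb'⟩ (by simp)).mono ?_ ?_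
  · rintro τ ⟨h, h1, h2, h3⟩ ht
    rw [test τ h] at ht
    refine (Ensures.store ?_).mono (by simp [Expr.cost]) fun _ h => h
    simp only [Expr.eval, Memory.set_self, Function.update_self]
    exact ⟨⟨h.set (by decide) _ _, by omega⟩, by omega⟩
  · simp only [Expr.cost, Expr.min]; omega
  · rintro τ ⟨⟨h, h1, h2, h3⟩, ht⟩
    rw [test τ h] at ht
    exact ⟨h, h1, h2, h3, by omega⟩

/-- A test for a number to lie between the cut points in the variables `16` and `15`, or between
those in the variables `15` and `10`. -/
def Expr.inGaps (z : Expr) : Expr :=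
  .add (.min (.sub z (.var 16)) (.sub (.var 15) z)) (.min (.sub z (.var 15)) (.sub (.var 10) z))

theorem Expr.eval_inGaps {z : Expr} {σ : Memory} :
    (Expr.inGaps z).eval σ ≠ 0 ↔ InGaps (σ 16 0) (σ 15 0) (σ 10 0) (z.eval σ) := by
  rw [Expr.inGaps, Expr.eval, Expr.eval_min, Expr.eval_min]
  simp only [Expr.eval, InGaps]
  omega

/-- Write the fault set of the current piece. -/
def Prog.markRow : Prog :=
  .forLoop 11 .faults (.store 7 (.add (.var 17) (.var 11))
    (.add (.inGaps (.endpoint 2)) (.inGaps (.endpoint 3))))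

theorem ensures_markRow {σ : Memory} {f g q p : ℕ} {z₁ z₂ : ℕ → ℕ} (hf : σ 0 1 = f)
    (hg : σ 16 0 = g) (hq : σ 15 0 = q) (hp : σ 10 0 = p) (hz₁ : ∀ j < f, σ 9 (σ 2 j) = z₁ j)
    (hz₂ : ∀ j < f, σ 9 (σ 3 j) = z₂ j) :
    Ensures .markRow σ (f * 150 + 150) fun τ => AgreeOff {7, 11} σ τ ∧
      (∀ i < σ 17 0, τ 7 i = σ 7 i) ∧
      ∀ j < f, τ 7 (σ 17 0 + j) ≠ 0 ↔ InGaps g q p (z₁ j) ∨ InGaps g q p (z₂ j) := by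
  refine (Ensures.forLoop (T := 120) (M := f) (fun m τ => AgreeOff {7, 11} σ τ ∧
      (∀ i < σ 17 0, τ 7 i = σ 7 i) ∧
      ∀ j < m, τ 7 (σ 17 0 + j) ≠ 0 ↔ InGaps g q p (z₁ j) ∨ InGaps g q p (z₂ j))
    ⟨.refl _ _, fun _ _ => rfl, by simp⟩ ?_ ?_ ?_).mono ?_ fun _ h => h
  · rintro i τ ⟨h, -⟩
    simp [Expr.eval, h 0 (by decide), hf]
  · rintro i τ x ⟨h, h'⟩
    exact ⟨h.set (by decide) _ _, by simpa [Memory.set_of_ne] using h'⟩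
  · rintro j τ hj ⟨h, h1, h2⟩ hc
    refine (Ensures.store ?_).mono (by simp [Expr.cost, Expr.inGaps, Expr.min]) fun _ h => h
    have e₁ : (Expr.inGaps (.endpoint 2)).eval τ ≠ 0 ↔ InGaps g q p (z₁ j) := by
      rw [Expr.eval_inGaps]
      simp only [Expr.eval, h 16 (by decide), h 15 (by decide), h 10 (by decide), h 9 (by decide),
        h 2 (by decide), hc, hz₁ j hj, hg, hq, hp]
    have e₂ : (Expr.inGaps (.endpoint 3)).eval τ ≠ 0 ↔ InGaps g q p (z₂ j) := by
      rw [Expr.eval_inGaps]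
      simp only [Expr.eval, h 16 (by decide), h 15 (by decide), h 10 (by decide), h 9 (by decide),
        h 3 (by decide), hc, hz₂ j hj, hg, hq, hp]
    rw [show ∀ x y : Expr, (Expr.add x y).eval τ = x.eval τ + y.eval τ from fun _ _ => rfl,
      show ∀ x y : Expr, (Expr.add x y).eval τ = x.eval τ + y.eval τ from fun _ _ => rfl]
    simp only [Expr.eval, h 17 (by decide), hc]
    refine ⟨by simpa [Memory.set_of_ne] using hc, h.set (by decide) _ _, fun i hi => ?_,
      fun i hi => ?_⟩
    · rw [Memory.set_self, Function.update_of_ne (by omega), h1 i hi]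
    · rw [Memory.set_self]
      by_cases hij : i = j
      · rw [hij, Function.update_self, ← e₁, ← e₂]
        omega
      · rw [Function.update_of_ne (by omega)]
        exact h2 i (by omega)
  · simp only [Expr.cost]; omega

/-- `row` marks the fault set of a piece of the path that runs from number `a` to number `b`. -/
def IsPiece (f k l : ℕ) (z₁ z₂ : ℕ → ℕ) (a b : ℕ) (row : ℕ → ℕ) : Prop :=
  a ≤ b ∧ b ≤ l ∧ (0 < l → a < b) ∧ ∃ g q p, (a = b ∨ g + q ≤ 2 * a + 1) ∧ 2 * b ≤ q + p ∧
    (k + k) * endpointCount z₁ z₂ f (fun z => g < z ∧ z < q) ≤ f ∧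
    (k + k) * endpointCount z₁ z₂ f (fun z => q < z ∧ z < p) ≤ f ∧
    ∀ j < f, row j ≠ 0 ↔ InGaps g q p (z₁ j) ∨ InGaps g q p (z₂ j)

/-- The output arrays describe a sequence of pieces. -/
structure Pieces (f k l : ℕ) (z₁ z₂ : ℕ → ℕ) (τ : Memory) : Prop where
  base : τ 17 0 = τ 5 0 * f
  start : τ 6 0 = 0
  isPiece : ∀ i < τ 5 0, IsPiece f k l z₁ z₂ (τ 6 i) (τ 6 (i + 1)) fun j => τ 7 (i * f + j)

theorem Pieces.congr {f k l : ℕ} {z₁ z₂ : ℕ → ℕ} {σ τ : Memory} (h : Pieces f k l z₁ z₂ σ)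
    (h5 : τ 5 = σ 5) (h6 : τ 6 = σ 6) (h7 : τ 7 = σ 7) (h17 : τ 17 = σ 17) :
    Pieces f k l z₁ z₂ τ := by
  constructor
  · rw [h5, h17, h.base]
  · rw [h6, h.start]
  · rw [h5, h6, h7]
    exact h.isPiece

/-- Close the current piece unless it is empty. -/
def Prog.closePiece : Prog :=
  .ite (.add (.sub (.var 14) (.get 6 (.var 5))) (.sub (.lit 1) .len))
    (.seq .markRow (.seq (.store 17 (.lit 0) (.add (.var 17) .faults))
      (.seq (.store 5 (.lit 0) (.add (.var 5) (.lit 1))) (.store 6 (.var 5) (.var 14)))))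
    .skip

/-- Cuts that do not move the boundary produce no piece. The exception is `l = 0`, where all pieces
are empty but at least one is required. -/
theorem ensures_closePiece {σ : Memory} {f k l g q p : ℕ} {z₁ z₂ : ℕ → ℕ} (hf : σ 0 1 = f)
    (hl : σ 0 3 = l) (hg : σ 16 0 = g) (hq : σ 15 0 = q) (hp : σ 10 0 = p)
    (hz₁ : ∀ j < f, σ 9 (σ 2 j) = z₁ j) (hz₂ : ∀ j < f, σ 9 (σ 3 j) = z₂ j)
    (hσ : Pieces f k l z₁ z₂ σ) (hab : σ 6 (σ 5 0) ≤ σ 14 0) (hbl : σ 14 0 ≤ l)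
    (ha : σ 6 (σ 5 0) = σ 14 0 ∨ g + q ≤ 2 * σ 6 (σ 5 0) + 1) (hb : 2 * σ 14 0 ≤ q + p)
    (hgq : (k + k) * endpointCount z₁ z₂ f (fun z => g < z ∧ z < q) ≤ f)
    (hqp : (k + k) * endpointCount z₁ z₂ f (fun z => q < z ∧ z < p) ≤ f) :
    Ensures .closePiece σ (f * 150 + 250) fun τ => AgreeOff {5, 6, 7, 11, 17} σ τ ∧
      Pieces f k l z₁ z₂ τ ∧ τ 6 (τ 5 0) = σ 14 0 ∧ τ 5 0 ≤ σ 5 0 + 1 ∧ (l = 0 → 0 < τ 5 0) := by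
  refine (Ensures.ite (T := f * 150 + 200) (fun ht => ?_) fun ht => ?_).mono
    (by simp [Expr.cost]; omega) fun _ h => h
  · refine (Ensures.seq (ensures_markRow hf hg hq hp hz₁ hz₂) fun τ ⟨h, h1, h2⟩ =>
      Ensures.store_seq (Ensures.store_seq (Ensures.store ?_))).mono
        (by simp [Expr.cost]) fun _ h => h
    simp only [Expr.eval, hl, ne_eq] at ht
    rw [hσ.base] at h1 h2
    simp only [Expr.eval, Memory.set_self, Memory.set_of_ne (show (5 : ℕ) ≠ 17 by decide),
      Memory.set_of_ne (show (14 : ℕ) ≠ 17 by decide), Memory.set_of_ne (show (14 : ℕ) ≠ 5 by decide),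
      Function.update_self, h 5 (by decide), h 17 (by decide), h 14 (by decide), h 0 (by decide), hf]
    refine ⟨(((h.mono (by decide)).set (by decide) _ _).set (by decide) _ _).set (by decide) _ _,
      ⟨?_, ?_, ?_⟩, ?_, ?_, ?_⟩
    · simp [Memory.set_of_ne, Memory.set_self, hσ.base, Nat.add_mul]
    · simp [Memory.set_of_ne, Memory.set_self, h 6 (by decide), hσ.start]
    · simp only [Memory.set_self, Memory.set_of_ne (show (5 : ℕ) ≠ 6 by decide),
        Memory.set_of_ne (show (6 : ℕ) ≠ 5 by decide), Memory.set_of_ne (show (6 : ℕ) ≠ 17 by decide),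
        Memory.set_of_ne (show (7 : ℕ) ≠ 6 by decide), Memory.set_of_ne (show (7 : ℕ) ≠ 5 by decide),
        Memory.set_of_ne (show (7 : ℕ) ≠ 17 by decide), Function.update_self, h 6 (by decide)]
      intro i hi
      rw [Function.update_of_ne (by omega)]
      rcases Nat.lt_succ_iff_lt_or_eq.1 hi with hi | rfl
      · rw [Function.update_of_ne (by omega)]
        obtain ⟨p1, p2, p3, g', q', p', p4, p5, p6, p7, p8⟩ := hσ.isPiece i hi
        refine ⟨p1, p2, p3, g', q', p', p4, p5, p6, p7, fun j hj => ?_⟩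
        change τ 7 (i * f + j) ≠ 0 ↔ _
        -- Row `i` ends before the current base, since `(i + 1) * f ≤ σ 5 0 * f`.
        rw [h1 _ (by nlinarith)]
        exact p8 j hj
      · rw [Function.update_self]
        exact ⟨hab, hbl, fun hl => by omega, g, q, p, ha, hb, hgq, hqp, h2⟩
    · simp [Memory.set_of_ne, Memory.set_self]
    · simp [Memory.set_of_ne, Memory.set_self]
    · simp [Memory.set_of_ne, Memory.set_self]
  · refine (Ensures.skip ?_).mono (by omega) fun _ h => h
    simp only [Expr.eval, hl] at ht
    exact ⟨.refl _ _, hσ, by omega, by omega, by omega⟩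

/-! ### The greedy scan and its invariant -/

/-- Close the current piece at a new cut point and update the list of the recent cut points. -/
def Prog.cut : Prog :=
  .seq .advance (.seq .closePiece (.seq (.store 16 (.lit 0) (.var 15))
    (.seq (.store 15 (.lit 0) (.var 10)) (.store 13 (.lit 0) (.lit 0)))))

/-- Treat the fault endpoints of the current potential.  Cut if there are too many of them since
the last cut point, or beyond the end of the path. -/
def Prog.scanStep : Prog :=
  .seq .countEndpoints (.ite (.add (.sub (.var 13) .faults) (.sub (.var 10) (.add .len .len)))
    .cut .skip)

/-- Cut the path into pieces. -/
def Prog.scan : Prog := .forLoop 10 (.add (.add .len .len) (.lit 2)) .scanStep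

/-- The invariant of `Prog.scan` after the potentials smaller than `p`. -/
structure ScanInv (f k l : ℕ) (z₁ z₂ : ℕ → ℕ) (σ : Memory) (p : ℕ) (τ : Memory) : Prop where
  agree : AgreeOff {5, 6, 7, 10, 11, 13, 14, 15, 16, 17} σ τ
  pieces : Pieces f k l z₁ z₂ τ
  last : τ 6 (τ 5 0) = τ 14 0
  le_len : τ 14 0 ≤ l
  le_mid : 2 * τ 14 0 ≤ τ 16 0 + τ 15 0
  mid_le : τ 14 0 = l ∨ τ 16 0 + τ 15 0 ≤ 2 * τ 14 0 + 1
  cut_le : τ 16 0 ≤ p ∧ τ 15 0 ≤ p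
  acc_le : τ 13 0 ≤ f
  gap : (k + k) * endpointCount z₁ z₂ f (fun z => τ 16 0 < z ∧ z < τ 15 0) ≤ f
  le_acc : (k + k) * endpointCount z₁ z₂ f (fun z => τ 15 0 < z ∧ z < p) ≤ τ 13 0
  count : τ 5 0 * (f + 1) + τ 13 0 ≤ (k + k) * endpointCount z₁ z₂ f (· < p) +
    if p = l + l + 2 then f + 1 else 0
  final : p = l + l + 2 → τ 15 0 = l + l + 1 ∧ (l = 0 → 0 < τ 5 0)

/-- The gap that a cut at `p` closes is open, so it is bounded by the accumulator before the
endpoints at `p` were added, which is at most `f`. With these endpoints the accumulator exceeds `f`,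
and this pays for the piece. -/
theorem ensures_scanStep {σ τ : Memory} {f k l p : ℕ} {z₁ z₂ : ℕ → ℕ} (hf : σ 0 1 = f)
    (hk : σ 0 2 = k) (hl : σ 0 3 = l) (hz₁ : ∀ j < f, σ 9 (σ 2 j) = z₁ j)
    (hz₂ : ∀ j < f, σ 9 (σ 3 j) = z₂ j) (hτ : ScanInv f k l z₁ z₂ σ p τ) (hp : τ 10 0 = p)
    (hpl : p < l + l + 2) :
    Ensures .scanStep τ (f * 250 + l * 50 + 500) fun υ =>
      υ 10 0 = p ∧ ScanInv f k l z₁ z₂ σ (p + 1) υ := by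
  have hlt : endpointCount z₁ z₂ f (· < p) + endpointCount z₁ z₂ f (· = p) ≤
      endpointCount z₁ z₂ f (· < p + 1) :=
    endpointCount_add_le (fun _ h => by omega) (fun _ h => by omega) fun _ h => by omega
  have hgap : endpointCount z₁ z₂ f (fun z => τ 15 0 < z ∧ z < p + 1) ≤
      endpointCount z₁ z₂ f (fun z => τ 15 0 < z ∧ z < p) + endpointCount z₁ z₂ f (· = p) :=
    endpointCount_le_add fun _ h => by omega
  have hlt' := Nat.mul_le_mul_left (k + k) hlt
  have hgap' := Nat.mul_le_mul_left (k + k) hgap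
  rw [Nat.mul_add] at hlt' hgap'
  have hA := hτ.agree
  have hcount := hτ.count
  have hle_acc := hτ.le_acc
  rw [if_neg (by omega)] at hcount
  refine (Ensures.seq (ensures_countEndpoints (σ := τ) (f := f) (k := k) (p := p) (z₁ := z₁)
    (z₂ := z₂) ?_ ?_ hp ?_ ?_) fun υ ⟨h, h13⟩ => ?_).mono (T := f * 100 + 100 +
      (f * 150 + l * 50 + 400)) (by omega) fun _ h => h
  · rw [hA 0 (by decide), hf]
  · rw [hA 0 (by decide), hk]
  · rw [hA 9 (by decide), hA 2 (by decide)]; exact hz₁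
  · rw [hA 9 (by decide), hA 3 (by decide)]; exact hz₂
  have hυ : Pieces f k l z₁ z₂ υ := hτ.pieces.congr (h 5 (by decide)) (h 6 (by decide))
    (h 7 (by decide)) (h 17 (by decide))
  have hB : AgreeOff {5, 6, 7, 10, 11, 13, 14, 15, 16, 17} σ υ := hA.trans (h.mono (by decide))
  refine (Ensures.ite (T := f * 150 + l * 50 + 350) (fun ht => ?_) fun ht => ?_).mono
    (by simp [Expr.cost]; omega) fun _ h => h
  · simp only [Expr.eval, hB 0 (by decide), hf, hl, h 10 (by decide), hp, ne_eq] at ht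
    refine (Ensures.seq (T₂ := f * 150 + 300)
      (ensures_advance (l := l) (q := τ 15 0) (p := p) ?_ ?_ ?_ ?_ ?_)
      fun ρ ⟨g, g1, g2, g3, g4⟩ => ?_).mono (by omega) fun _ h => h
    · rw [hB 0 (by decide), hl]
    · rw [h 15 (by decide)]
    · rw [h 10 (by decide), hp]
    · rw [h 14 (by decide)]; exact hτ.le_len
    · rw [h 14 (by decide)]
      have := hτ.le_mid
      have := hτ.cut_le
      omega
    refine (Ensures.seq (T₂ := 50) (ensures_closePiece (f := f) (k := k) (l := l) (g := τ 16 0)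
      (q := τ 15 0) (p := p) (z₁ := z₁) (z₂ := z₂) ?_ ?_ ?_ ?_ ?_ ?_ ?_ ?_ ?_ g2 ?_ g3 hτ.gap
      (hle_acc.trans hτ.acc_le)) fun ω ⟨e, e1, e2, e3, e4⟩ => ?_).mono (by omega) fun _ h => h
    · rw [g 0 (by decide), hB 0 (by decide), hf]
    · rw [g 0 (by decide), hB 0 (by decide), hl]
    · rw [g 16 (by decide), h 16 (by decide)]
    · rw [g 15 (by decide), h 15 (by decide)]
    · rw [g 10 (by decide), h 10 (by decide), hp]
    · rw [g 9 (by decide), hB 9 (by decide), g 2 (by decide), hB 2 (by decide)]; exact hz₁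
    · rw [g 9 (by decide), hB 9 (by decide), g 3 (by decide), hB 3 (by decide)]; exact hz₂
    · exact hυ.congr (g 5 (by decide)) (g 6 (by decide)) (g 7 (by decide)) (g 17 (by decide))
    · rw [g 6 (by decide), g 5 (by decide), h 6 (by decide), h 5 (by decide), hτ.last,
        ← h 14 (by decide)]
      exact g1
    -- If the old boundary was already `l`, the new one is too, and the piece is empty.
    · rw [g 6 (by decide), g 5 (by decide), h 6 (by decide), h 5 (by decide), hτ.last]
      rw [h 14 (by decide)] at g1
      have := hτ.mid_le
      omega
    · refine (Ensures.store_seq (Ensures.store_seq (Ensures.store ?_))).mono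
        (by simp [Expr.cost]) fun _ h => h
      have hC : AgreeOff {5, 6, 7, 11, 13, 14, 17} τ ω :=
        ((h.mono (by decide)).trans (g.mono (by decide))).trans (e.mono (by decide))
      simp only [Expr.eval, Memory.set_of_ne (show (10 : ℕ) ≠ 16 by decide), hC 15 (by decide),
        hC 10 (by decide), hp]
      have h5 : ω 5 0 ≤ τ 5 0 + 1 := by
        rwa [g 5 (by decide), h 5 (by decide)] at e3
      rw [← e 14 (by decide)] at e2 g2 g3 g4
      refine ⟨by simp [Memory.set_of_ne, hC 10 (by decide), hp], ?_⟩
      constructor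
      · exact (((hA.trans (hC.mono (by decide))).set (by decide) _ _).set (by decide) _ _).set
          (by decide) _ _
      · exact e1.congr (by simp [Memory.set_of_ne]) (by simp [Memory.set_of_ne])
          (by simp [Memory.set_of_ne]) (by simp [Memory.set_of_ne])
      · simpa [Memory.set_of_ne] using e2
      · simpa [Memory.set_of_ne] using g2
      · simpa [Memory.set_of_ne, Memory.set_self] using g3
      · simpa [Memory.set_of_ne, Memory.set_self] using g4
      · have := hτ.cut_le
        simp [Memory.set_of_ne, Memory.set_self]
        omega
      · simp [Memory.set_self]
      · simp only [Memory.set_self, Memory.set_of_ne (show (16 : ℕ) ≠ 13 by decide),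
          Memory.set_of_ne (show (16 : ℕ) ≠ 15 by decide),
          Memory.set_of_ne (show (15 : ℕ) ≠ 13 by decide), Function.update_self]
        exact hle_acc.trans hτ.acc_le
      · rw [endpointCount_eq_zero]
        · simp
        · intro z
          simp [Memory.set_of_ne, Memory.set_self]
      · simp only [Memory.set_self, Memory.set_of_ne (show (5 : ℕ) ≠ 13 by decide),
          Memory.set_of_ne (show (5 : ℕ) ≠ 15 by decide),
          Memory.set_of_ne (show (5 : ℕ) ≠ 16 by decide), Function.update_self]
        -- A new piece costs `f + 1`. The accumulator covers it, except possibly at the forced cut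
        -- `p = 2l + 1`, where the extra allowance in `count` does.
        have h5' := Nat.mul_le_mul_right (f + 1) h5
        rw [Nat.add_mul] at h5'
        split_ifs with hlast <;> omega
      · intro hlast
        simp [Memory.set_of_ne, Memory.set_self]
        exact ⟨by omega, e4⟩
  · simp only [Expr.eval, hB 0 (by decide), hf, hl, h 10 (by decide), hp] at ht
    refine (Ensures.skip ?_).mono (by omega) fun _ h => h
    refine ⟨by rw [h 10 (by decide), hp], hB, hυ, ?_, ?_, ?_, ?_, ?_, ?_, ?_, ?_, ?_, ?_⟩
    · rw [h 6 (by decide), h 5 (by decide), h 14 (by decide), hτ.last]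
    · rw [h 14 (by decide)]; exact hτ.le_len
    · rw [h 14 (by decide), h 15 (by decide), h 16 (by decide)]; exact hτ.le_mid
    · rw [h 14 (by decide), h 15 (by decide), h 16 (by decide)]; exact hτ.mid_le
    · rw [h 15 (by decide), h 16 (by decide)]
      have := hτ.cut_le
      omega
    · omega
    · rw [h 15 (by decide), h 16 (by decide)]; exact hτ.gap
    · rw [h 15 (by decide)]
      omega
    · rw [h 5 (by decide), if_neg (by omega)]
      omega
    · intro hlast
      omega

theorem ensures_scan {σ : Memory} {f k l : ℕ} {z₁ z₂ : ℕ → ℕ} (hf : σ 0 1 = f)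
    (hk : σ 0 2 = k) (hl : σ 0 3 = l) (hz₁ : ∀ j < f, σ 9 (σ 2 j) = z₁ j)
    (hz₂ : ∀ j < f, σ 9 (σ 3 j) = z₂ j)
    (h0 : ∀ a ∈ ({5, 6, 7, 13, 14, 15, 16, 17} : Finset ℕ), ∀ i, σ a i = 0) :
    Ensures .scan σ ((l + l + 2) * (f * 250 + l * 50 + 550) + 50)
      (ScanInv f k l z₁ z₂ σ (l + l + 2)) := by
  refine (Ensures.forLoop (T := f * 250 + l * 50 + 500) (M := l + l + 2)
    (ScanInv f k l z₁ z₂ σ) ?_ ?_ ?_ ?_).mono ?_ fun _ h => h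
  · have h5 := h0 5 (by decide)
    have h6 := h0 6 (by decide)
    have h13 := h0 13 (by decide)
    have h14 := h0 14 (by decide)
    have h15 := h0 15 (by decide)
    have h16 := h0 16 (by decide)
    have h17 := h0 17 (by decide)
    -- Both recent cut points start at 0, so endpoints of potential 0 never lie in a gap.
    exact ⟨.refl _ _, ⟨by simp [h5, h17], by simp [h6], by simp [h5]⟩, by simp [h6, h14],
      by simp [h14], by simp [h14], by simp [h15, h16], by simp [h15, h16], by simp [h13],
      by rw [endpointCount_eq_zero (by simp [h15])]; simp,
      by rw [endpointCount_eq_zero (by simp)]; simp, by simp [h5, h13], fun h => by omega⟩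
  · rintro i τ h
    simp [Expr.eval, h.agree 0 (by decide), hl]
  · rintro i τ x h
    have hne : ∀ {a}, a ≠ 10 → τ.set 10 0 x a = τ a := fun h => Memory.set_of_ne h
    obtain ⟨c1, c2, c3, c4, c5, c6, c7, c8, c9, c10, c11, c12⟩ := h
    refine ⟨c1.set (by decide) _ _, c2.congr ?_ ?_ ?_ ?_, ?_, ?_, ?_, ?_, ?_, ?_, ?_, ?_, ?_, ?_⟩
    all_goals
      simp only [hne (show (5 : ℕ) ≠ 10 by decide), hne (show (6 : ℕ) ≠ 10 by decide),
        hne (show (7 : ℕ) ≠ 10 by decide), hne (show (13 : ℕ) ≠ 10 by decide),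
      hne (show (14 : ℕ) ≠ 10 by decide), hne (show (15 : ℕ) ≠ 10 by decide),
      hne (show (16 : ℕ) ≠ 10 by decide), hne (show (17 : ℕ) ≠ 10 by decide)]
      try assumption
  · intro i τ hi h hc
    exact ensures_scanStep hf hk hl hz₁ hz₂ h hc hi
  · have hcost : (Expr.add (.add .len .len) (.lit 2)).cost ≤ 20 := by simp [Expr.cost]
    have := Nat.mul_le_mul_left (l + l + 2) (show f * 250 + l * 50 + 500 +
      (Expr.add (.add .len .len) (.lit 2)).cost + 10 ≤ f * 250 + l * 50 + 550 by omega)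
    linarith

/-! ### The output -/

section Output

variable {n : ℕ} {L : List (Fin n × Fin n)} {F : Finset (Sym2 (Fin n))}

theorem Enumerates.card_eq {V : Type*} [DecidableEq V] {L : List (V × V)} {F : Finset (Sym2 V)}
    (h : Enumerates L F) : L.length = F.card := by
  have : F = (L.map fun e => s(e.1, e.2)).toFinset := by
    ext e
    rw [h.2, List.mem_toFinset]
  rw [this, List.toFinset_card_of_nodup h.1, List.length_map]

theorem Enumerates.exists_get {V : Type*} {L : List (V × V)} {F : Finset (Sym2 V)}
    (h : Enumerates L F) {e : Sym2 V} (he : e ∈ F) :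
    ∃ j : Fin L.length, s((L.get j).1, (L.get j).2) = e := by
  obtain ⟨a, ha, rfl⟩ := List.mem_map.1 ((h.2 e).1 he)
  obtain ⟨j, rfl⟩ := List.mem_iff_get.1 ha
  exact ⟨j, rfl⟩

theorem Enumerates.get_mem {V : Type*} {L : List (V × V)} {F : Finset (Sym2 V)}
    (h : Enumerates L F) (j : Fin L.length) : s((L.get j).1, (L.get j).2) ∈ F :=
  (h.2 _).2 (List.mem_map.2 ⟨_, List.get_mem L j, rfl⟩)

theorem outFaults_subset (h : Enumerates L F) (τ : Memory) (i : ℕ) : outFaults L τ i ⊆ F := by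
  intro e he
  obtain ⟨j, -, rfl⟩ := Finset.mem_image.1 he
  exact h.get_mem j

instance (g q p : ℕ) : DecidablePred (InGaps g q p) := fun z => by
  unfold InGaps
  infer_instance

theorem card_outFaults_le {τ : Memory} {i g q p : ℕ} {z₁ z₂ : ℕ → ℕ}
    (h : ∀ j < L.length, τ 7 (i * L.length + j) ≠ 0 ↔ InGaps g q p (z₁ j) ∨ InGaps g q p (z₂ j)) :
    (outFaults L τ i).card ≤ endpointCount z₁ z₂ L.length (fun z => g < z ∧ z < q) +
      endpointCount z₁ z₂ L.length (fun z => q < z ∧ z < p) := by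
  refine le_trans ?_ (endpointCount_le_add (P := InGaps g q p) fun _ h => h)
  refine Finset.card_image_le.trans ((Finset.card_le_card_of_injOn (fun j : Fin L.length => (j : ℕ))
    (t := (Finset.range L.length).filter fun j => InGaps g q p (z₁ j) ∨ InGaps g q p (z₂ j))
    (fun j hj => ?_) (fun _ _ _ _ => Fin.ext)).trans ?_)
  · simp only [Finset.coe_filter, Finset.mem_univ, true_and, Set.mem_ofPred_eq] at hj
    simp only [Finset.coe_filter, Finset.mem_range, Set.mem_ofPred_eq]
    exact ⟨j.2, (h j j.2).1 hj⟩
  · rw [Finset.filter_or]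
    exact Finset.card_union_le _ _

/-- Each of the two gaps has at most `f / (2k)` endpoints, and every marked fault has an endpoint in
one of them. -/
theorem IsPiece.spec {G : SimpleGraph (Fin n)} {s t : Fin n} {π : G.Walk s t}
    (hL : Enumerates L F) (hπ : IsShortestPathAvoiding π (F : Set (Sym2 (Fin n)))) {y : ℕ → ℕ}
    (hy : ∀ u v : Fin n, (G.deleteEdges (F : Set (Sym2 (Fin n)))).Adj u v → y u ≤ y v + 1)
    (hyπ : ∀ i ≤ π.length, y (π.getVert i) = i) {z₁ z₂ : ℕ → ℕ}
    (hz₁ : ∀ j : Fin L.length, z₁ j = y (L.get j).1)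
    (hz₂ : ∀ j : Fin L.length, z₂ j = y (L.get j).2) {k a b i : ℕ} (hk : 1 ≤ k) {τ : Memory}
    (h : IsPiece L.length k π.length z₁ z₂ a b fun j => τ 7 (i * L.length + j)) :
    ((outFaults L τ i).card : ℚ) ≤ (F.card : ℚ) / (k : ℚ) ∧
      IsShortestPathAvoiding (subwalk π a b) (outFaults L τ i : Set (Sym2 (Fin n))) := by
  obtain ⟨hab, hb, -, g, q, p, hga, hbq, hgq, hqp, hrow⟩ := h
  constructor
  · have hcard := card_outFaults_le hrow
    rw [le_div_iff₀ (by exact_mod_cast hk)]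
    have := Nat.mul_le_mul_right k hcard
    have : (outFaults L τ i).card * k ≤ F.card := by
      rw [← hL.card_eq]
      linarith
    exact_mod_cast this
  · refine isShortestPathAvoiding_subwalk (y := fun v : Fin n => y v) hπ hy hyπ
      (Finset.coe_subset.2 (outFaults_subset hL τ i)) hab hb hga hbq fun u v hF hS => ?_
    obtain ⟨j, hj⟩ := hL.exists_get hF
    have hj0 : ¬ (InGaps g q p (z₁ j) ∨ InGaps g q p (z₂ j)) := by
      rw [← hrow j j.2]
      intro hne
      exact hS (Finset.mem_coe.2 (Finset.mem_image.2
        ⟨j, Finset.mem_filter.2 ⟨Finset.mem_univ _, hne⟩, hj⟩))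
    rw [hz₁, hz₂, not_or] at hj0
    rcases Sym2.eq_iff.1 hj with ⟨h1, -⟩ | ⟨-, h2⟩
    · rw [← h1]; exact hj0.1
    · rw [← h2]; exact hj0.2

end Output

/-! ### The input -/

section Input

variable {n : ℕ} {G : SimpleGraph (Fin n)} {L : List (Fin n × Fin n)} {s t : Fin n}
  {π : G.Walk s t} {k : ℕ}

theorem mul_add_inj {u v u' v' : ℕ} (hv : v < n) (hv' : v' < n) :
    u * n + v = u' * n + v' ↔ u = u' ∧ v = v' := by
  refine ⟨fun h => ?_, fun ⟨h, h'⟩ => by rw [h, h']⟩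
  have hn : 0 < n := by omega
  have h1 : (u * n + v) / n = u := by
    rw [Nat.mul_comm, Nat.mul_add_div hn, Nat.div_eq_of_lt hv, Nat.add_zero]
  have h2 : (u' * n + v') / n = u' := by
    rw [Nat.mul_comm, Nat.mul_add_div hn, Nat.div_eq_of_lt hv', Nat.add_zero]
  have hu : u = u' := by rw [← h1, h, h2]
  subst hu
  omega

theorem inputMemory_matrix (u v : Fin n) : inputMemory G L π k 1 (u * n + v) ≠ 0 ↔ G.Adj u v := by
  classical
  simp only [inputMemory]
  rw [ne_eq, ite_eq_right_iff]
  simp only [one_ne_zero, imp_false, not_not]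
  constructor
  · rintro ⟨u', v', h, hadj⟩
    obtain ⟨h1, h2⟩ := (mul_add_inj v.2 v'.2).1 h
    rwa [Fin.ext h1, Fin.ext h2]
  · exact fun h => ⟨u, v, rfl, h⟩

theorem inputMemory_fst (j : Fin L.length) : inputMemory G L π k 2 j = (L.get j).1 := by
  simp [inputMemory]

theorem inputMemory_snd (j : Fin L.length) : inputMemory G L π k 3 j = (L.get j).2 := by
  simp [inputMemory]

theorem inputMemory_path : inputMemory G L π k 4 π.length = t := by
  have := π.getVert_eq_support_getElem le_rfl
  rw [SimpleGraph.Walk.getVert_length] at this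
  simp [inputMemory, ← List.map_eq_flatMap, ← this]

theorem inputMemory_zero {a : ℕ} (ha : 5 ≤ a) (i : ℕ) : inputMemory G L π k a i = 0 := by
  obtain ⟨b, rfl⟩ := Nat.exists_eq_add_of_le ha
  rw [Nat.add_comm]
  rfl

/-! ### The whole algorithm -/

/-- The algorithm of the restoration lemma.  It places all fault endpoints on the line by their
potential, which agrees with the position on the path.  Then it chooses cut points with few
endpoints between consecutive ones, and splits the path in the middle between these; a piece needs
only the faults with an endpoint strictly between its cut point and a neighbouring one. -/
def restoration : Prog := .seq .rowOffsets (.seq .deleteFaults (.seq .potential .scan))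

/-- The parameter `k` is only ever added, never used as a loop bound, so it does not occur. -/
theorem restoration_time {n f l : ℕ} (hl : l ≤ n) :
    n * 30 + 30 + (f * 40 + 40 + (l * (n * (n * 60 + 60) + 60) + 60 +
      ((l + l + 2) * (f * 250 + l * 50 + 550) + 50))) ≤ 5000 * (n + f + 1) ^ 3 := by
  obtain ⟨N, hN⟩ : ∃ N, N = n + f + 1 := ⟨_, rfl⟩
  rw [← hN]
  have h1 : 1 ≤ N := by omega
  have hn : n ≤ N := by omega
  have hf : f ≤ N := by omega
  have hlN : l ≤ N := by omega
  have h2 : N ≤ N ^ 2 := by nlinarith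
  have h3 : N ^ 2 ≤ N ^ 3 := Nat.pow_le_pow_right h1 (by norm_num)
  calc _ ≤ N * 30 + 30 + (N * 40 + 40 + (N * (N * (N * 60 + 60) + 60) + 60 +
      ((N + N + 2) * (N * 250 + N * 50 + 550) + 50))) := by gcongr
    _ ≤ _ := by nlinarith

theorem ensures_restoration {F : Finset (Sym2 (Fin n))} (hL : Enumerates L F) :
    Ensures restoration (inputMemory G L π k) (n * 30 + 30 + (L.length * 40 + 40 +
      (π.length * (n * (n * 60 + 60) + 60) + 60 + ((π.length + π.length + 2) *
        (L.length * 250 + π.length * 50 + 550) + 50)))) fun τ => ∃ (y : ℕ → ℕ) (σ : Memory),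
      PotSound (G.deleteEdges (F : Set (Sym2 (Fin n)))) t π.length y ∧
      PotFull (G.deleteEdges (F : Set (Sym2 (Fin n)))) t π.length π.length y ∧
      ScanInv L.length k π.length (fun j => y (inputMemory G L π k 2 j))
        (fun j => y (inputMemory G L π k 3 j)) σ (π.length + π.length + 2) τ := by
  set ι := inputMemory G L π k with hι
  have hι₁ : ∀ j < L.length, ι 2 j < n := fun j hj => by
    rw [hι, inputMemory_fst ⟨j, hj⟩]
    exact (L.get ⟨j, hj⟩).1.2
  have hι₂ : ∀ j < L.length, ι 3 j < n := fun j hj => by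
    rw [hι, inputMemory_snd ⟨j, hj⟩]
    exact (L.get ⟨j, hj⟩).2.2
  refine Ensures.seq (ensures_rowOffsets rfl (inputMemory_zero (by norm_num) _))
    fun τ₁ ⟨a₁, h8⟩ => ?_
  refine Ensures.seq (ensures_deleteFaults (n := n) (f := L.length) (e₁ := ι 2) (e₂ := ι 3) ?_ h8
    ?_ ?_ hι₁ hι₂) fun τ₂ ⟨a₂, hm⟩ => ?_
  · rw [a₁ 0 (by decide)]; rfl
  · rw [a₁ 2 (by decide)]; exact fun _ _ => rfl
  · rw [a₁ 3 (by decide)]; exact fun _ _ => rfl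
  have b₂ : AgreeOff {1, 8, 10} ι τ₂ := (a₁.mono (by decide)).trans (a₂.mono (by decide))
  refine Ensures.seq (ensures_potential (n := n) (l := π.length) (t := t)
    (H := G.deleteEdges (F : Set (Sym2 (Fin n)))) ?_ ?_ ?_ ?_ ?_ fun u v => ?_)
    fun τ₃ ⟨a₃, hs, hf⟩ => ?_
  · rw [b₂ 0 (by decide)]; rfl
  · rw [b₂ 0 (by decide)]; rfl
  · rw [b₂ 4 (by decide)]; exact inputMemory_path
  · rw [a₂ 8 (by decide)]; exact h8
  · rw [b₂ 9 (by decide)]; exact inputMemory_zero (by norm_num)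
  · rw [hm, a₁ 1 (by decide), inputMemory_matrix, SimpleGraph.deleteEdges_adj]
    refine and_congr_right fun _ => ?_
    constructor
    · intro h hF
      obtain ⟨j, hj⟩ := hL.exists_get hF
      have := h j j.2
      rw [hι, inputMemory_fst, inputMemory_snd] at this
      rcases Sym2.eq_iff.1 hj with ⟨h1, h2⟩ | ⟨h1, h2⟩
      · exact this.1 (by rw [h1, h2])
      · exact this.2 (by rw [h1, h2])
    · intro hF j hj
      rw [hι, inputMemory_fst ⟨j, hj⟩, inputMemory_snd ⟨j, hj⟩]
      have hmem := hL.get_mem ⟨j, hj⟩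
      constructor
      · intro h
        obtain ⟨h1, h2⟩ := (mul_add_inj v.2 (Fin.is_lt _)).1 h
        rw [← Fin.ext h1, ← Fin.ext h2] at hmem
        exact hF hmem
      · intro h
        obtain ⟨h1, h2⟩ := (mul_add_inj v.2 (Fin.is_lt _)).1 h
        rw [← Fin.ext h1, ← Fin.ext h2, Sym2.eq_swap] at hmem
        exact hF hmem
  have b₃ : AgreeOff {1, 8, 9, 10, 11, 12} ι τ₃ :=
    (b₂.mono (by decide)).trans (a₃.mono (by decide))
  refine (ensures_scan (σ := τ₃) (f := L.length) (k := k) (l := π.length)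
    (z₁ := fun j => τ₃ 9 (ι 2 j)) (z₂ := fun j => τ₃ 9 (ι 3 j)) ?_ ?_ ?_ ?_ ?_ ?_).mono le_rfl
    fun τ h => ⟨τ₃ 9, τ₃, hs, hf, h⟩
  · rw [b₃ 0 (by decide)]; rfl
  · rw [b₃ 0 (by decide)]; rfl
  · rw [b₃ 0 (by decide)]; rfl
  · rw [b₃ 2 (by decide)]; exact fun _ _ => rfl
  · rw [b₃ 3 (by decide)]; exact fun _ _ => rfl
  · intro a ha i
    rw [b₃ a (by revert a; decide)]
    exact inputMemory_zero (by revert a; decide) i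

end Input

/-! ### Number of pieces and end of the path -/

theorem ScanInv.count_le {f k l : ℕ} {z₁ z₂ : ℕ → ℕ} {σ τ : Memory} (hk : 1 ≤ k)
    (h : ScanInv f k l z₁ z₂ σ (l + l + 2) τ) : τ 5 0 ≤ 4 * k := by
  have h1 := h.count
  rw [if_pos rfl] at h1
  have h2 := Nat.mul_le_mul_left (k + k)
    (endpointCount_le (z₁ := z₁) (z₂ := z₂) (f := f) (P := (· < l + l + 2)))
  by_contra hlt
  -- The total budget is `4kf + f + 1`, while `4k + 1` pieces would cost `4kf + 4k + f + 1`.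
  have h3 := Nat.mul_le_mul_right (f + 1) (show 4 * k + 1 ≤ τ 5 0 by omega)
  nlinarith

/-- The forced cut at `2l + 1` has its middle with any earlier cut point at `l` or beyond. -/
theorem ScanInv.last_eq {f k l : ℕ} {z₁ z₂ : ℕ → ℕ} {σ τ : Memory}
    (h : ScanInv f k l z₁ z₂ σ (l + l + 2) τ) : τ 6 (τ 5 0) = l := by
  have h1 := h.last
  have h2 := h.le_len
  have h3 := h.mid_le
  have h4 := (h.final rfl).1
  omega

theorem ScanInv.count_pos {f k l : ℕ} {z₁ z₂ : ℕ → ℕ} {σ τ : Memory}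
    (h : ScanInv f k l z₁ z₂ σ (l + l + 2) τ) : 0 < τ 5 0 := by
  rcases Nat.eq_zero_or_pos l with hl | hl
  · exact (h.final rfl).2 hl
  · by_contra h0
    have h1 := h.last_eq
    rw [show τ 5 0 = 0 by omega, h.pieces.start] at h1
    omega

end PathRestoration

theorem theorem1p6 :
    ∃ (alg : Prog) (C c d : ℕ),
      ∀ (n : ℕ) (G : SimpleGraph (Fin n)) (F : Finset (Sym2 (Fin n)))
        (L : List (Fin n × Fin n)) (s t : Fin n) (π : G.Walk s t) (k : ℕ),
        (F : Set (Sym2 (Fin n))) ⊆ G.edgeSet → Enumerates L F →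
        IsShortestPathAvoiding π (F : Set (Sym2 (Fin n))) → 1 ≤ k →
        ∃ (out : Memory) (T : ℕ),
          Runs alg (inputMemory G L π k) out T ∧
          T ≤ c * (n + F.card + 1) ^ d ∧
          ∃ q : ℕ,
            outCount out = q + 1 ∧ q + 1 ≤ C * k ∧
            outBoundary out 0 = 0 ∧ outBoundary out (q + 1) = π.length ∧
            ∀ i ≤ q,
              outBoundary out i ≤ outBoundary out (i + 1) ∧
              (0 < π.length → outBoundary out i < outBoundary out (i + 1)) ∧
              outFaults L out i ⊆ F ∧
              ((outFaults L out i).card : ℚ) ≤ (F.card : ℚ) / (k : ℚ) ∧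
              IsShortestPathAvoiding
                (subwalk π (outBoundary out i) (outBoundary out (i + 1)))
                (outFaults L out i : Set (Sym2 (Fin n))) := by
  refine ⟨restoration, 4, 5000, 3, fun n G F L s t π k _ hL hπ hk => ?_⟩
  obtain ⟨τ, T, hrun, hT, y, σ, hs, hf, hτ⟩ := ensures_restoration (G := G) (π := π) (k := k) hL
  have hlen : π.length ≤ n := by simpa using hπ.1.length_lt.le
  refine ⟨τ, T, hrun, ?_, τ 5 0 - 1, ?_⟩
  · rw [← hL.card_eq]
    exact hT.trans (restoration_time hlen)
  have hpos := hτ.count_pos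
  have hq : τ 5 0 - 1 + 1 = τ 5 0 := by omega
  rw [hq]
  refine ⟨rfl, hτ.count_le hk, hτ.pieces.start, hτ.last_eq, fun i hi => ?_⟩
  have hi := hτ.pieces.isPiece i (by omega)
  exact ⟨hi.1, hi.2.2.1, outFaults_subset hL τ i, hi.spec hL hπ
    (fun _ _ h => PotFull.le_add_one hs hf h) (fun _ h => PotFull.getVert hπ hs hf h)
    (fun j => by rw [inputMemory_fst]) (fun j => by rw [inputMemory_snd]) hk⟩
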